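/- Let $S_0(x)=x/3$ and $S_2(x)=(x+2)/3$, let $C\subset[0,1]$ be the middle-third Cantor set, and let $\mu$ be the symmetric Cantor measure, i.e. the unique Borel probability measure on $[0,1]$ with $\mu=\tfrac12\,\mu\circ S_0^{-1}+\tfrac12\,\mu\circ S_2^{-1}$; equivalently, $\mu$ is the law of $\sum_{n\ge1}\omega_n3^{-n}$ with $\omega_n$ independent and uniform on $\{0,2\}$. For a finite word $w=(w_1,\dots,w_n)\in\{0,2\}^n$ put $|w|=n$ and $C_w=S_{w_1}\circ\cdots\circ S_{w_n}(C)$, with $C_\varnothing=C$. On the (real or complex) Hilbert space $L^2(\mu)$ let $$K_mf=\sum_{|u|\le m}\langle 1_{C_u},f\rangle\,1_{C_u}\qquad(m\ge0),$$ let $E_n$ be the conditional expectation onto the $\sigma$-algebra generated by the cylinders $C_w$ with $|w|=n$, and let $$K_\infty=\sum_{n=0}^{\infty}2^{-n}E_n,$$ a series that converges in operator norm. For $0<r<\infty$ let $S_r$ be the Schatten class of all compact operators $T$ with $\sum_j s_j(T)^r<\infty$, where the $s_j(T)$ are the singular values of $T$ (the eigenvalues of $(T^*T)^{1/2}$), repeated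 according to multiplicity. Then $K_m\to K_\infty$ in operator norm, and for every real $r>0$, $$K_\infty\in S_r\iff r>1 .$$ In particular $K_\infty$ is Hilbert–Schmidt ($K_\infty\in S_2$) but not trace class ($K_\infty\notin S_1$). -/

import Mathlib

open MeasureTheory ProbabilityTheory Filter Topology
open scoped ENNReal InnerProductSpace

noncomputable section

namespace CantorFrame

/-! ### The Cantor maps, words and cylinders

Letters are coded by `Bool`: `false` stands for the digit `0` and `true` for the digit `2`.
A finite word is a `List Bool`, a word of length `n` is also a function `Fin n → Bool`.
The middle-third Cantor set is Mathlib's `cantorSet : Set ℝ`. -/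

/-- `S₀ x = x / 3` and `S₂ x = (x + 2) / 3`. -/
def branchMap (b : Bool) (x : ℝ) : ℝ := if b then (x + 2) / 3 else x / 3

/-- `S_w = S_{w₁} ∘ ⋯ ∘ S_{wₘ}`, with `S_∅ = id`. -/
def wordMap : List Bool → ℝ → ℝ
  | [] => id
  | b :: w => branchMap b ∘ wordMap w

/-- The Cantor cylinder `C_w = S_w(C)`. -/
def cylinder (w : List Bool) : Set ℝ := wordMap w '' cantorSet

lemma continuous_branchMap (b : Bool) : Continuous (branchMap b) := by
  cases b
  · show Continuous fun x : ℝ => x / 3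
    fun_prop
  · show Continuous fun x : ℝ => (x + 2) / 3
    fun_prop

lemma continuous_wordMap : ∀ w : List Bool, Continuous (wordMap w)
  | [] => continuous_id
  | b :: w => (continuous_branchMap b).comp (continuous_wordMap w)

lemma measurableSet_cylinder (w : List Bool) : MeasurableSet (cylinder w) :=
  (isCompact_cantorSet.image (continuous_wordMap w)).measurableSet

/-! ### The Bernoulli Cantor measure -/

/-- The coding map `ω ↦ ∑ ωₙ 3^{-(n+1)}` of infinite words with digits `0`, `2`. -/
def codingMap (ω : ℕ → Bool) : ℝ := Real.ofDigits (fun n => cond (ω n) (2 : Fin 3) 0)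

/-- The law of an infinite word whose letters are independent, each being `0` with probability
`p` and `2` with probability `1 - p`. -/
def wordMeasure (p : unitInterval) : Measure (ℕ → Bool) :=
  Measure.infinitePi (fun _ : ℕ => bernoulliMeasure false true p)

/-- The Bernoulli Cantor measure `μ_p`, as a Borel measure on `ℝ` (it is carried by the Cantor
set, see `cantorMeasure_cantorSet`, and is self-similar, see `cantorMeasure_selfSimilar`). -/
def cantorMeasure (p : unitInterval) : Measure ℝ := (wordMeasure p).map codingMap

lemma continuous_codingMap : Continuous codingMap := by
  unfold codingMap
  refine Real.continuous_ofDigits.comp (continuous_pi fun n => ?_)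
  exact (continuous_of_discreteTopology (f := fun b : Bool => cond b (2 : Fin 3) 0)).comp
    (continuous_apply n)

instance (p : unitInterval) : IsProbabilityMeasure (wordMeasure p) := by
  unfold wordMeasure; infer_instance

instance (p : unitInterval) : IsProbabilityMeasure (cantorMeasure p) :=
  Measure.isProbabilityMeasure_map continuous_codingMap.measurable.aemeasurable

lemma cantorMeasure_cantorSet (p : unitInterval) : cantorMeasure p cantorSet = 1 := by
  rw [cantorMeasure, Measure.map_apply continuous_codingMap.measurable
    isCompact_cantorSet.measurableSet]
  have : codingMap ⁻¹' cantorSet = Set.univ :=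
    Set.eq_univ_of_forall fun ω => ofDigits_bool_to_fin_three_mem_cantorSet ω
  rw [this, measure_univ]

/-- Prepend a letter to an infinite word. -/
def consWord (b : Bool) (ω : ℕ → Bool) : ℕ → Bool
  | 0 => b
  | n + 1 => ω n

lemma measurable_consWord (b : Bool) : Measurable (consWord b) := by
  refine measurable_pi_iff.2 fun n => ?_
  cases n with
  | zero => exact measurable_const
  | succ n => exact measurable_pi_apply n

lemma codingMap_consWord (b : Bool) (ω : ℕ → Bool) :
    codingMap (consWord b ω) = branchMap b (codingMap ω) := by
  unfold codingMap
  rw [Real.ofDigits_eq_sum_add_ofDigits _ 1]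
  cases b <;> simp [Real.ofDigitsTerm, consWord, branchMap, add_comm] <;> ring

lemma wordMeasure_eq (p : unitInterval) :
    wordMeasure p = ENNReal.ofReal p • (wordMeasure p).map (consWord false) +
      ENNReal.ofReal (1 - p) • (wordMeasure p).map (consWord true) := by
  classical
  symm
  rw [wordMeasure]
  refine Measure.eq_infinitePi _ fun s t _ => ?_
  obtain ⟨N, hN⟩ : ∃ N, s ⊆ Finset.range (N + 1) :=
    ⟨s.sup id, fun i hi => Finset.mem_range.2 (Nat.lt_succ_of_le (Finset.le_sup (f := id) hi))⟩
  set u : ℕ → Set Bool := fun i => if i ∈ s then t i else Set.univ with hu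
  have hum : ∀ i, MeasurableSet (u i) := fun i => MeasurableSet.of_discrete
  have hpi : Set.pi (s : Set ℕ) t = Set.pi (Finset.range (N + 1) : Set ℕ) u := by
    ext ω
    simp only [Set.mem_pi, Finset.mem_coe, hu]
    constructor
    · intro h i _
      by_cases hi : i ∈ s
      · simpa [hi] using h i hi
      · simp [hi]
    · intro h i hi
      simpa [hi] using h i (hN hi)
  have hprod : ∏ i ∈ s, bernoulliMeasure false true p (t i) =
      ∏ i ∈ Finset.range (N + 1), bernoulliMeasure false true p (u i) := by
    rw [← Finset.prod_subset hN (f := fun i => bernoulliMeasure false true p (u i))]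
    · exact Finset.prod_congr rfl fun i hi => by simp [hu, hi]
    · intro i _ hi
      simp [hu, hi]
  have hbox : MeasurableSet (Set.pi (Finset.range (N + 1) : Set ℕ) u) :=
    MeasurableSet.pi (Finset.countable_toSet _) fun i _ => hum i
  have hcons : ∀ b, ((Measure.infinitePi fun _ : ℕ => bernoulliMeasure false true p).map
      (consWord b)) (Set.pi (Finset.range (N + 1) : Set ℕ) u) =
      (u 0).indicator 1 b * ∏ i ∈ Finset.range N, bernoulliMeasure false true p (u (i + 1)) := by
    intro b
    rw [Measure.map_apply (measurable_consWord b) hbox]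
    by_cases hb : b ∈ u 0
    · have : consWord b ⁻¹' Set.pi (Finset.range (N + 1) : Set ℕ) u =
          Set.pi (Finset.range N : Set ℕ) fun i => u (i + 1) := by
        ext ω
        simp only [Set.mem_preimage, Set.mem_pi, Finset.coe_range, Set.mem_Iio]
        constructor
        · intro h i hi
          exact h (i + 1) (by omega)
        · intro h i hi
          cases i with
          | zero => exact hb
          | succ i => exact h i (by omega)
      rw [this, Measure.infinitePi_pi _ fun i _ => hum _]
      simp [hb]
    · have : consWord b ⁻¹' Set.pi (Finset.range (N + 1) : Set ℕ) u = ∅ := by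
        ext ω
        simp only [Set.mem_preimage, Set.mem_pi, Finset.coe_range, Set.mem_Iio,
          Set.mem_empty_iff_false, iff_false]
        exact fun h => hb (h 0 (by omega))
      rw [this]
      simp [hb]
  have hber : bernoulliMeasure false true p (u 0) =
      ENNReal.ofReal p * (u 0).indicator 1 false +
        ENNReal.ofReal (1 - p) * (u 0).indicator 1 true := by
    rw [bernoulliMeasure_def]
    simp only [Measure.add_apply, Measure.smul_apply, Measure.dirac_apply' _ (hum 0)]
    congr 1
    · rw [ENNReal.smul_def, smul_eq_mul]
      congr 1
      exact (ENNReal.ofReal_eq_coe_nnreal p.2.1).symm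
    · rw [ENNReal.smul_def, smul_eq_mul]
      congr 1
      exact (ENNReal.ofReal_eq_coe_nnreal (unitInterval.symm p).2.1).symm
  rw [hpi, hprod, Finset.prod_range_succ', Measure.add_apply, Measure.smul_apply,
    Measure.smul_apply, hcons, hcons, hber, smul_eq_mul, smul_eq_mul]
  ring

/-- The self-similarity `μ_p = p μ_p ∘ S₀⁻¹ + (1 - p) μ_p ∘ S₂⁻¹`. -/
lemma cantorMeasure_selfSimilar (p : unitInterval) :
    cantorMeasure p = ENNReal.ofReal p • (cantorMeasure p).map (branchMap false) +
      ENNReal.ofReal (1 - p) • (cantorMeasure p).map (branchMap true) := by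
  have key : ∀ b, (cantorMeasure p).map (branchMap b) =
      ((wordMeasure p).map (consWord b)).map codingMap := fun b => by
    rw [cantorMeasure, Measure.map_map (continuous_branchMap b).measurable
      continuous_codingMap.measurable, Measure.map_map continuous_codingMap.measurable
      (measurable_consWord b)]
    congr 1
    funext ω
    exact (codingMap_consWord b ω).symm
  rw [key, key, ← Measure.map_smul (μ := (wordMeasure p).map (consWord false)),
    ← Measure.map_smul (μ := (wordMeasure p).map (consWord true)),
    ← Measure.map_add _ _ continuous_codingMap.measurable, ← wordMeasure_eq, cantorMeasure]

/-! ### Cylinder indicators, frame operators, conditional expectations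

`𝕜` is the scalar field, `ℝ` or `ℂ`. -/

/-- The indicator `1_{C_w}` as an element of `L²(μ_p)`. -/
def cylinderIndicator (𝕜 : Type*) [RCLike 𝕜] (p : unitInterval) (w : List Bool) :
    Lp 𝕜 2 (cantorMeasure p) :=
  indicatorConstLp 2 (measurableSet_cylinder w) (measure_ne_top _ _) (1 : 𝕜)

/-- The cylinder frame operator `K_m f = ∑_{|u| ≤ m} ⟨1_{C_u}, f⟩ 1_{C_u}` on `L²(μ_p)`. -/
def frameOperator (𝕜 : Type*) [RCLike 𝕜] (p : unitInterval) (m : ℕ) :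
    Lp 𝕜 2 (cantorMeasure p) →L[𝕜] Lp 𝕜 2 (cantorMeasure p) :=
  ∑ n ∈ Finset.range (m + 1), ∑ u : Fin n → Bool,
    InnerProductSpace.rankOne 𝕜 (cylinderIndicator 𝕜 p (List.ofFn u))
      (cylinderIndicator 𝕜 p (List.ofFn u))

/-- The `σ`-algebra `𝒢_n` generated by the cylinders of level `n`. -/
@[reducible] def levelSigma (n : ℕ) : MeasurableSpace ℝ :=
  MeasurableSpace.generateFrom (Set.range fun w : Fin n → Bool => cylinder (List.ofFn w))

lemma levelSigma_le (n : ℕ) : levelSigma n ≤ Real.measurableSpace := by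
  refine MeasurableSpace.generateFrom_le ?_
  rintro _ ⟨w, rfl⟩
  exact measurableSet_cylinder _

/-- The conditional expectation `E_n : L²(μ_p) → L²(μ_p)` onto `𝒢_n`. -/
def levelExpectation (𝕜 : Type*) [RCLike 𝕜] (p : unitInterval) (n : ℕ) :
    Lp 𝕜 2 (cantorMeasure p) →L[𝕜] Lp 𝕜 2 (cantorMeasure p) :=
  (lpMeas 𝕜 𝕜 (levelSigma n) 2 (cantorMeasure p)).subtypeL ∘L
    condExpL2 𝕜 𝕜 (levelSigma_le n)

/-- The parameter `p = 1/2`. -/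
def half : unitInterval := ⟨1 / 2, by norm_num, by norm_num⟩

/-- The symmetric limit operator `K_∞ = ∑ₙ 2⁻ⁿ E_n` on `L²(μ_{1/2})`; the series converges in
operator norm, see `summable_limitOperator`. -/
def limitOperator (𝕜 : Type*) [RCLike 𝕜] :
    Lp 𝕜 2 (cantorMeasure half) →L[𝕜] Lp 𝕜 2 (cantorMeasure half) :=
  ∑' n : ℕ, ((2 : 𝕜)⁻¹ ^ n) • levelExpectation 𝕜 half n

lemma norm_levelExpectation_le (𝕜 : Type*) [RCLike 𝕜] (p : unitInterval) (n : ℕ) :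
    ‖levelExpectation 𝕜 p n‖ ≤ 1 := by
  refine ContinuousLinearMap.opNorm_le_bound _ zero_le_one fun f => ?_
  rw [one_mul]
  exact norm_condExpL2_le (levelSigma_le n) f

lemma summable_limitOperator (𝕜 : Type*) [RCLike 𝕜] :
    Summable fun n : ℕ => ((2 : 𝕜)⁻¹ ^ n) • levelExpectation 𝕜 half n := by
  refine Summable.of_norm_bounded (g := fun n : ℕ => (2⁻¹ : ℝ) ^ n)
    (summable_geometric_of_lt_one (by norm_num) (by norm_num)) fun n => ?_
  rw [norm_smul, norm_pow, norm_inv, RCLike.norm_ofNat]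
  exact mul_le_of_le_one_right (by positivity) (norm_levelExpectation_le 𝕜 half n)

/-! ### Schatten classes -/

section Schatten

variable {𝕜 : Type*} [RCLike 𝕜] {H : Type*} [NormedAddCommGroup H] [InnerProductSpace 𝕜 H]
  [CompleteSpace H]

/-- The multiplicity of `s > 0` as a singular value of the compact operator `T`, that is, as an
eigenvalue of `|T| = (T* T)^{1/2}`: the dimension of the eigenspace of `T* T` for `s²`. It is
`0` if `s` is not a singular value, and it is finite if `T` is compact. -/
def singularMultiplicity (T : H →L[𝕜] H) (s : ℝ) : ℕ :=
  Module.finrank 𝕜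
    (Module.End.eigenspace (ContinuousLinearMap.adjoint T ∘L T : H →L[𝕜] H).toLinearMap
      ((s ^ 2 : ℝ) : 𝕜))

/-- `T ∈ S_r`: the operator `T` is compact and `∑ s_j(T)^r < ∞`, the sum being over the nonzero
singular values of `T`, each repeated according to its multiplicity. -/
def MemSchatten (T : H →L[𝕜] H) (r : ℝ) : Prop :=
  IsCompactOperator T ∧
    Summable fun s : {s : ℝ // 0 < s} => (singularMultiplicity T s : ℝ) * (s : ℝ) ^ r

/-- The Hilbert–Schmidt class is `S_2`. -/
def IsHilbertSchmidt (T : H →L[𝕜] H) : Prop := MemSchatten T 2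

/-- The trace class is `S_1`. -/
def IsTraceClass (T : H →L[𝕜] H) : Prop := MemSchatten T 1

end Schatten

end CantorFrame

end

/-! Let V_n be the span of the 2^n indicators of the level-n cylinders. Since μ charges only the
Cantor set, which these cylinders partition, E_n is the orthogonal projection onto V_n
(`levelExpectation_eq_starProjection`). For p = 1/2 the indicators are orthogonal with equal squared
norm 2⁻ⁿ, so the level-n part of K_m is exactly 2⁻ⁿ E_n (`sum_rankOne_cylinderIndicator`). Thus K_m
is a partial sum of the series for K_∞.

The V_n increase. On V_n ⊖ V_{n-1} the projection E_k is 0 for k < n and the identity for k ≥ n, so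
K_∞ acts there as the scalar ∑_{k≥n} 2⁻ᵏ = 2·2⁻ⁿ, while it vanishes on vectors orthogonal to every
V_n. The nonzero singular values are therefore 2, once, and 2⁻ⁿ with multiplicity 2ⁿ for n ≥ 0.
Hence ∑ s_j^r is, up to one term, the geometric series of ratio 2^(1-r), convergent iff r > 1
(`memSchatten_dyadicSum_iff`). -/

namespace CantorFrame

/-! ### Dyadic sums of projections onto an increasing sequence of subspaces -/

section Filtration

variable {𝕜 : Type*} [RCLike 𝕜] {H : Type*} [NormedAddCommGroup H] [InnerProductSpace 𝕜 H]

/-- The orthogonal increments `V 0, V 1 ⊖ V 0, V 2 ⊖ V 1, …` of a sequence of subspaces. -/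
def increment (V : ℕ → Submodule 𝕜 H) : ℕ → Submodule 𝕜 H
  | 0 => V 0
  | n + 1 => (V n)ᗮ ⊓ V (n + 1)

/-- The operator `∑ₙ 2⁻ⁿ Pₙ`, where `Pₙ` is the orthogonal projection onto `V n`. -/
noncomputable def dyadicSum (V : ℕ → Submodule 𝕜 H) [∀ n, (V n).HasOrthogonalProjection] : H →L[𝕜] H :=
  ∑' n : ℕ, ((2 : 𝕜)⁻¹ ^ n) • (V n).starProjection

/-- The `n`-th eigenvalue `2 · 2⁻ⁿ` of `dyadicSum`. -/
noncomputable def dyadicEigenvalue (n : ℕ) : ℝ := 2 * 2⁻¹ ^ n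

lemma dyadicEigenvalue_pos (n : ℕ) : 0 < dyadicEigenvalue n := by
  unfold dyadicEigenvalue; positivity

lemma dyadicEigenvalue_injective : Function.Injective dyadicEigenvalue := by
  intro a b h
  have h' : (2⁻¹ : ℝ) ^ a = 2⁻¹ ^ b := mul_left_cancel₀ two_ne_zero h
  exact pow_right_injective₀ (by norm_num) (by norm_num) h'

lemma increment_le (V : ℕ → Submodule 𝕜 H) (n : ℕ) : increment V n ≤ V n := by
  cases n with
  | zero => exact le_rfl
  | succ n => exact inf_le_right

lemma increment_le_orthogonal {V : ℕ → Submodule 𝕜 H} (hV : Monotone V) {k n : ℕ} (h : k < n) :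
    increment V n ≤ (V k)ᗮ := by
  cases n with
  | zero => omega
  | succ n => exact inf_le_left.trans (Submodule.orthogonal_le (hV (by omega)))

lemma finrank_increment_succ {V : ℕ → Submodule 𝕜 H} [∀ n, FiniteDimensional 𝕜 (V n)]
    (hV : Monotone V) (hdim : ∀ n, Module.finrank 𝕜 (V n) = 2 ^ n) (n : ℕ) :
    Module.finrank 𝕜 (increment V (n + 1)) = 2 ^ n := by
  have h := Submodule.finrank_add_inf_finrank_orthogonal (hV (Nat.le_succ n))
  rw [Nat.succ_eq_add_one, hdim, hdim] at h
  have : Module.finrank 𝕜 (increment V (n + 1)) =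
    Module.finrank 𝕜 ((V n)ᗮ ⊓ V (n + 1) : Submodule 𝕜 H) := rfl
  rw [this]
  omega

variable {V : ℕ → Submodule 𝕜 H}

/-- Induction on V (n+1) = V n ⊔ increment (n+1). Together with the vanishing of `dyadicSum` on such
vectors, this makes density of the union of the V n unnecessary. -/
lemma mem_orthogonal_of_mem_orthogonal_increment [∀ n, (V n).HasOrthogonalProjection]
    (hV : Monotone V) {f : H} (hf : ∀ k, f ∈ (increment V k)ᗮ) (n : ℕ) : f ∈ (V n)ᗮ := by
  induction n with
  | zero => exact hf 0
  | succ n ih =>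
    rw [← Submodule.sup_orthogonal_inf_of_hasOrthogonalProjection (hV (Nat.le_succ n)),
      ← Submodule.inf_orthogonal]
    exact ⟨ih, hf (n + 1)⟩

lemma summable_dyadicSum [CompleteSpace H] (V : ℕ → Submodule 𝕜 H)
    [∀ n, (V n).HasOrthogonalProjection] :
    Summable fun n : ℕ => ((2 : 𝕜)⁻¹ ^ n) • (V n).starProjection := by
  refine Summable.of_norm_bounded (g := fun n : ℕ => (2⁻¹ : ℝ) ^ n)
    (summable_geometric_of_lt_one (by norm_num) (by norm_num)) fun n => ?_
  rw [norm_smul, norm_pow, norm_inv, RCLike.norm_ofNat]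
  exact mul_le_of_le_one_right (by positivity) (Submodule.starProjection_norm_le _)

lemma hasSum_dyadicSum_apply [CompleteSpace H] (V : ℕ → Submodule 𝕜 H)
    [∀ n, (V n).HasOrthogonalProjection] (f : H) :
    HasSum (fun n : ℕ => ((2 : 𝕜)⁻¹ ^ n) • (V n).starProjection f) (dyadicSum V f) :=
  (summable_dyadicSum V).hasSum.mapL (ContinuousLinearMap.apply 𝕜 H f)

lemma hasSum_dyadic_tail (n : ℕ) :
    HasSum (fun k : ℕ => if n ≤ k then (2 : 𝕜)⁻¹ ^ k else 0) (dyadicEigenvalue n : 𝕜) := by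
  have hg : HasSum (fun k : ℕ => (2⁻¹ : ℝ) ^ k * 2⁻¹ ^ n) (2 * 2⁻¹ ^ n) := by
    have := hasSum_geometric_of_lt_one (r := (2⁻¹ : ℝ)) (by norm_num) (by norm_num)
    rw [show (1 - (2⁻¹ : ℝ))⁻¹ = 2 by norm_num] at this
    exact this.mul_right (2⁻¹ ^ n)
  have hg' : HasSum (fun k : ℕ => (2 : 𝕜)⁻¹ ^ (k + n)) (dyadicEigenvalue n : 𝕜) := by
    have := hg.mapL (RCLike.ofRealCLM (K := 𝕜))
    simpa [dyadicEigenvalue, pow_add, map_ofNat] using this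
  rw [← hasSum_nat_add_iff' n]
  have h0 : ∑ i ∈ Finset.range n, (if n ≤ i then (2 : 𝕜)⁻¹ ^ i else 0) = 0 :=
    Finset.sum_eq_zero fun i hi => if_neg (by simpa using hi)
  rw [h0, sub_zero]
  simpa using hg'

lemma dyadicSum_apply_of_mem_increment [CompleteSpace H] [∀ n, (V n).HasOrthogonalProjection]
    (hV : Monotone V) {n : ℕ} {f : H} (hf : f ∈ increment V n) :
    dyadicSum V f = (dyadicEigenvalue n : 𝕜) • f := by
  refine (hasSum_dyadicSum_apply V f).unique ?_
  convert! (hasSum_dyadic_tail (𝕜 := 𝕜) n).smul_const f using 1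
  funext k
  split_ifs with h
  · rw [Submodule.starProjection_eq_self_iff.2 (hV h (increment_le V n hf))]
  · rw [(Submodule.starProjection_apply_eq_zero_iff _).2
      (increment_le_orthogonal hV (not_le.1 h) hf), smul_zero, zero_smul]

lemma dyadicSum_apply_of_mem_orthogonal [CompleteSpace H] [∀ n, (V n).HasOrthogonalProjection]
    {f : H} (hf : ∀ n, f ∈ (V n)ᗮ) : dyadicSum V f = 0 := by
  refine (hasSum_dyadicSum_apply V f).unique ?_
  convert! hasSum_zero using 1
  funext k
  rw [(Submodule.starProjection_apply_eq_zero_iff _).2 (hf k), smul_zero]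

lemma adjoint_dyadicSum [CompleteSpace H] (V : ℕ → Submodule 𝕜 H)
    [∀ n, (V n).HasOrthogonalProjection] :
    ContinuousLinearMap.adjoint (dyadicSum V) = dyadicSum V := by
  rw [← ContinuousLinearMap.star_eq_adjoint, dyadicSum, tsum_star]
  congr 1
  funext n
  rw [star_smul, (isSelfAdjoint_starProjection (V n)).star_eq]
  simp

/-- The partial sums have finite rank and converge in norm. -/
lemma isCompactOperator_dyadicSum [CompleteSpace H] (V : ℕ → Submodule 𝕜 H)
    [∀ n, FiniteDimensional 𝕜 (V n)] : IsCompactOperator (dyadicSum V) := by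
  refine isCompactOperator_of_tendsto (summable_dyadicSum V).hasSum
    (Eventually.of_forall fun s => ?_)
  have hP : ∀ n, IsCompactOperator (V n).starProjection := fun n => by
    have : ProperSpace (V n) := FiniteDimensional.proper_rclike 𝕜 _
    have h : IsCompactOperator (V n).orthogonalProjectionOnto :=
      isCompactOperator_of_locallyCompactSpace_dom _
    exact h.clm_comp (V n).subtypeL
  classical
  induction s using Finset.induction_on with
  | empty => simpa using isCompactOperator_zero
  | insert a s ha ih =>
    rw [Finset.sum_insert ha]
    exact ((hP a).smul _).add ih

/-! ### Singular values of the dyadic sum and their multiplicities -/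

lemma mem_eigenspace_adjoint_comp_dyadicSum [CompleteSpace H]
    [∀ n, (V n).HasOrthogonalProjection] {s : ℝ} {f : H} :
    f ∈ Module.End.eigenspace (ContinuousLinearMap.adjoint (dyadicSum V) ∘L dyadicSum V :
      H →L[𝕜] H).toLinearMap ((s ^ 2 : ℝ) : 𝕜) ↔
    dyadicSum V (dyadicSum V f) = ((s ^ 2 : ℝ) : 𝕜) • f := by
  rw [Module.End.mem_eigenspace_iff, adjoint_dyadicSum]
  rfl

/-- Eigenvectors of a symmetric operator for different eigenvalues are orthogonal, so `f` is
orthogonal to every increment whose eigenvalue is not `s`; the hypothesis `h` covers the others.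
Then `dyadicSum` kills `f`, and s² ≠ 0 forces f = 0. This serves both to exclude other singular
values and to bound the eigenspaces from above. -/
lemma eq_zero_of_dyadicSum_sq [CompleteSpace H] [∀ n, (V n).HasOrthogonalProjection]
    (hV : Monotone V) {s : ℝ} (hs : 0 < s) {f : H}
    (hf : dyadicSum V (dyadicSum V f) = ((s ^ 2 : ℝ) : 𝕜) • f)
    (h : ∀ n, dyadicEigenvalue n = s → f ∈ (increment V n)ᗮ) : f = 0 := by
  have hsymm : ∀ x y : H, ⟪dyadicSum V x, y⟫_𝕜 = ⟪x, dyadicSum V y⟫_𝕜 := fun x y => by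
    conv_lhs => rw [← adjoint_dyadicSum V]
    exact ContinuousLinearMap.adjoint_inner_left _ _ _
  have hperp : ∀ n, f ∈ (increment V n)ᗮ := by
    intro n
    by_cases hn : dyadicEigenvalue n = s
    · exact h n hn
    refine (Submodule.mem_orthogonal _ _).2 fun g hg => ?_
    have h1 : ⟪dyadicSum V (dyadicSum V g), f⟫_𝕜 = ⟪g, dyadicSum V (dyadicSum V f)⟫_𝕜 := by
      rw [hsymm, hsymm]
    rw [hf, dyadicSum_apply_of_mem_increment hV hg, map_smul,
      dyadicSum_apply_of_mem_increment hV hg, inner_smul_left, inner_smul_left, inner_smul_right,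
      RCLike.conj_ofReal] at h1
    have h2 : (((dyadicEigenvalue n) ^ 2 - s ^ 2 : ℝ) : 𝕜) * ⟪g, f⟫_𝕜 = 0 := by
      push_cast at h1 ⊢
      linear_combination h1
    refine (mul_eq_zero.1 h2).resolve_left fun h0 => hn ?_
    have h3 := RCLike.ofReal_eq_zero.1 h0
    exact (pow_left_inj₀ (dyadicEigenvalue_pos n).le hs.le two_ne_zero).1 (sub_eq_zero.1 h3)
  rw [dyadicSum_apply_of_mem_orthogonal (mem_orthogonal_of_mem_orthogonal_increment hV hperp),
    map_zero] at hf
  refine (smul_eq_zero.1 hf.symm).resolve_left ?_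
  exact RCLike.ofReal_ne_zero.2 (pow_pos hs 2).ne'

lemma singularMultiplicity_dyadicSum_eq_zero [CompleteSpace H]
    [∀ n, (V n).HasOrthogonalProjection] (hV : Monotone V) {s : ℝ} (hs : 0 < s)
    (h : ∀ n, dyadicEigenvalue n ≠ s) : singularMultiplicity (dyadicSum V) s = 0 := by
  have : Module.End.eigenspace (ContinuousLinearMap.adjoint (dyadicSum V) ∘L dyadicSum V :
      H →L[𝕜] H).toLinearMap ((s ^ 2 : ℝ) : 𝕜) = ⊥ :=
    (Submodule.eq_bot_iff _).2 fun f hf => eq_zero_of_dyadicSum_sq hV hs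
      (mem_eigenspace_adjoint_comp_dyadicSum.1 hf) fun n hn => absurd hn (h n)
  rw [singularMultiplicity, this, finrank_bot]

lemma singularMultiplicity_dyadicSum [CompleteSpace H] [∀ n, FiniteDimensional 𝕜 (V n)]
    (hV : Monotone V) (n : ℕ) :
    singularMultiplicity (dyadicSum V) (dyadicEigenvalue n) =
      Module.finrank 𝕜 (increment V n) := by
  have hsub : ∀ g ∈ increment V n, dyadicSum V (dyadicSum V g) =
      ((dyadicEigenvalue n ^ 2 : ℝ) : 𝕜) • g := fun g hg => by
    rw [dyadicSum_apply_of_mem_increment hV hg, map_smul,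
      dyadicSum_apply_of_mem_increment hV hg, smul_smul]
    push_cast
    rw [sq]
  have : FiniteDimensional 𝕜 (increment V n) :=
    Submodule.finiteDimensional_of_le (increment_le V n)
  have : Module.End.eigenspace (ContinuousLinearMap.adjoint (dyadicSum V) ∘L dyadicSum V :
      H →L[𝕜] H).toLinearMap ((dyadicEigenvalue n ^ 2 : ℝ) : 𝕜) = increment V n := by
    refine le_antisymm (fun f hf => ?_) fun g hg =>
      mem_eigenspace_adjoint_comp_dyadicSum.2 (hsub g hg)
    rw [mem_eigenspace_adjoint_comp_dyadicSum] at hf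
    have hmem := Submodule.starProjection_apply_mem (increment V n) f
    -- The difference is again an eigenvector for the same value, and it is orthogonal to the only
    -- increment carrying that value.
    have h0 : f - (increment V n).starProjection f = 0 := by
      refine eq_zero_of_dyadicSum_sq hV (dyadicEigenvalue_pos n) ?_ fun k hk => ?_
      · rw [map_sub, map_sub, hf, hsub _ hmem, smul_sub]
      · rw [dyadicEigenvalue_injective hk]
        exact Submodule.sub_starProjection_mem_orthogonal f
    rw [sub_eq_zero.1 h0]
    exact hmem
  rw [singularMultiplicity, this]

lemma memSchatten_dyadicSum_iff [CompleteSpace H] [∀ n, FiniteDimensional 𝕜 (V n)]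
    (hV : Monotone V) (hdim : ∀ n, Module.finrank 𝕜 (V n) = 2 ^ n) (r : ℝ) :
    MemSchatten (dyadicSum V) r ↔ 1 < r := by
  let e : ℕ → {s : ℝ // 0 < s} := fun n => ⟨dyadicEigenvalue n, dyadicEigenvalue_pos n⟩
  have he : Function.Injective e := fun a b h =>
    dyadicEigenvalue_injective (congrArg Subtype.val h)
  -- Only the values `dyadicEigenvalue n` contribute. The term n = 0 is dropped because the
  -- increment formula 2ⁿ starts at index 1.
  rw [MemSchatten, and_iff_right (isCompactOperator_dyadicSum V), ← he.summable_iff,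
    ← summable_nat_add_iff 1]
  -- Index n + 1 gives the value 2⁻ⁿ with multiplicity 2ⁿ, hence the term 2ⁿ · 2^(-nr).
  · have : ((fun n => ((fun s : {s : ℝ // 0 < s} =>
        (singularMultiplicity (dyadicSum V) s : ℝ) * (s : ℝ) ^ r) ∘ e) (n + 1))) =
        fun n : ℕ => ((2 : ℝ) ^ (1 - r)) ^ n := by
      funext n
      simp only [Function.comp_apply, e]
      rw [singularMultiplicity_dyadicSum hV, finrank_increment_succ hV hdim]
      have h2 : dyadicEigenvalue (n + 1) = (2 : ℝ) ^ (-(n : ℝ)) := by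
        rw [dyadicEigenvalue, Real.rpow_neg two_pos.le, Real.rpow_natCast, pow_succ, inv_pow]
        ring
      rw [h2, ← Real.rpow_mul two_pos.le, ← Real.rpow_natCast, ← Real.rpow_mul two_pos.le]
      push_cast
      rw [← Real.rpow_natCast, ← Real.rpow_add two_pos]
      congr 1
      ring
    rw [this, summable_geometric_iff_norm_lt_one, Real.norm_of_nonneg (by positivity),
      Real.rpow_lt_one_iff_of_pos two_pos]
    constructor
    · rintro (h | h)
      · linarith
      · linarith [h.1]
    · intro h
      exact Or.inl ⟨by norm_num, by linarith⟩
  · intro s hs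
    rw [singularMultiplicity_dyadicSum_eq_zero hV s.2 fun n hn => hs ⟨n, Subtype.ext hn⟩]
    simp

end Filtration

end CantorFrame
namespace CantorFrame

/-! ### Geometry and measure of the cylinders -/

lemma branchMap_injective (b : Bool) : Function.Injective (branchMap b) := by
  intro x y h
  cases b <;> simp only [branchMap, if_true, Bool.false_eq_true, if_false] at h <;> linarith

lemma branchMap_mem_Icc (b : Bool) {x : ℝ} (hx : x ∈ Set.Icc (0 : ℝ) 1) :
    branchMap b x ∈ Set.Icc (0 : ℝ) 1 := by
  obtain ⟨h0, h1⟩ := hx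
  cases b <;> simp only [branchMap, if_true, Bool.false_eq_true, if_false] <;>
    constructor <;> linarith

lemma eq_of_branchMap_eq {b c : Bool} {x y : ℝ} (hx : x ∈ Set.Icc (0 : ℝ) 1)
    (hy : y ∈ Set.Icc (0 : ℝ) 1) (h : branchMap b x = branchMap c y) : b = c := by
  obtain ⟨h0, h1⟩ := hx
  obtain ⟨h2, h3⟩ := hy
  cases b <;> cases c <;> simp only [branchMap, if_true, Bool.false_eq_true, if_false] at h <;>
    first | rfl | linarith

lemma cylinder_cons (b : Bool) (w : List Bool) :
    cylinder (b :: w) = branchMap b '' cylinder w :=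
  Set.image_comp _ _ _

lemma cylinder_subset_Icc (w : List Bool) : cylinder w ⊆ Set.Icc 0 1 := by
  induction w with
  | nil => simpa [cylinder, wordMap] using cantorSet_subset_unitInterval
  | cons b w ih =>
    rw [cylinder_cons]
    rintro _ ⟨x, hx, rfl⟩
    exact branchMap_mem_Icc b (ih hx)

lemma cylinder_nonempty (w : List Bool) : (cylinder w).Nonempty :=
  ⟨_, Set.mem_image_of_mem _ zero_mem_cantorSet⟩

lemma disjoint_cylinder {v w : List Bool} (hlen : v.length = w.length) (h : v ≠ w) :
    Disjoint (cylinder v) (cylinder w) := by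
  induction v generalizing w with
  | nil => exact absurd (List.length_eq_zero_iff.1 hlen.symm).symm h
  | cons b v ih =>
    cases w with
    | nil => simp at hlen
    | cons c w =>
      rw [cylinder_cons, cylinder_cons, Set.disjoint_left]
      rintro _ ⟨x, hx, rfl⟩ ⟨y, hy, hxy⟩
      obtain rfl := eq_of_branchMap_eq (cylinder_subset_Icc _ hy) (cylinder_subset_Icc _ hx) hxy
      obtain rfl := branchMap_injective _ hxy
      have hvw : v ≠ w := fun e => h (by rw [e])
      exact Set.disjoint_left.1 (ih (by simpa using hlen) hvw) hx hy

lemma cantorSet_eq_union_branchMap :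
    cantorSet = branchMap false '' cantorSet ∪ branchMap true '' cantorSet := by
  have h0 : branchMap false = fun x => x / 3 := by funext x; simp [branchMap]
  have h1 : branchMap true = fun x => (2 + x) / 3 := by funext x; simp [branchMap, add_comm]
  rw [h0, h1]
  exact cantorSet_eq_union_halves

lemma wordMap_append_singleton (w : List Bool) (b : Bool) :
    wordMap (w ++ [b]) = wordMap w ∘ branchMap b := by
  induction w with
  | nil => rfl
  | cons c w ih => simp [wordMap, ih, Function.comp_assoc]

lemma cylinder_eq_union (w : List Bool) :
    cylinder w = cylinder (w ++ [false]) ∪ cylinder (w ++ [true]) := by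
  rw [cylinder, cylinder, cylinder, wordMap_append_singleton, wordMap_append_singleton,
    Set.image_comp, Set.image_comp, ← Set.image_union, ← cantorSet_eq_union_branchMap]

lemma exists_mem_cylinder {x : ℝ} (hx : x ∈ cantorSet) (n : ℕ) :
    ∃ u : Fin n → Bool, x ∈ cylinder (List.ofFn u) := by
  induction n generalizing x with
  | zero => exact ⟨Fin.elim0, by simpa [cylinder, wordMap] using hx⟩
  | succ n ih =>
    have key : ∀ b, x ∈ branchMap b '' cantorSet →
        ∃ u : Fin (n + 1) → Bool, x ∈ cylinder (List.ofFn u) := by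
      rintro b ⟨y, hy, rfl⟩
      obtain ⟨u, hu⟩ := ih hy
      refine ⟨Fin.cons b u, ?_⟩
      rw [List.ofFn_cons, cylinder_cons]
      exact Set.mem_image_of_mem _ hu
    rw [cantorSet_eq_union_branchMap] at hx
    exact hx.elim (key _) (key _)

lemma ae_mem_cantorSet (p : unitInterval) : ∀ᵐ x ∂(cantorMeasure p), x ∈ cantorSet :=
  (mem_ae_iff_prob_eq_one isCompact_cantorSet.measurableSet).2 (cantorMeasure_cantorSet p)

/-- The two branches send [0,1] to disjoint intervals. The preimage itself can be nonempty, since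
`branchMap b` is defined on all of ℝ, but it misses the Cantor set. -/
lemma cantorMeasure_branchMap_preimage_cylinder_cons (p : unitInterval) {b c : Bool}
    (h : b ≠ c) (w : List Bool) :
    cantorMeasure p (branchMap b ⁻¹' cylinder (c :: w)) = 0 := by
  rw [measure_eq_zero_iff_ae_notMem]
  filter_upwards [ae_mem_cantorSet p] with x hx hxc
  rw [cylinder_cons] at hxc
  obtain ⟨y, hy, hxy⟩ := hxc
  exact h (eq_of_branchMap_eq (cylinder_subset_Icc _ hy) (cantorSet_subset_unitInterval hx)
    hxy).symm

lemma branchMap_preimage_cylinder_cons (b : Bool) (w : List Bool) :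
    branchMap b ⁻¹' cylinder (b :: w) = cylinder w := by
  rw [cylinder_cons, Set.preimage_image_eq _ (branchMap_injective b)]

lemma cantorMeasure_half_cylinder (w : List Bool) :
    cantorMeasure half (cylinder w) = 2⁻¹ ^ w.length := by
  induction w with
  | nil => simpa [cylinder, wordMap] using cantorMeasure_cantorSet half
  | cons b w ih =>
    have h0 : ENNReal.ofReal (half : ℝ) = 2⁻¹ := by
      rw [show (half : ℝ) = 2⁻¹ from one_div 2, ENNReal.ofReal_inv_of_pos two_pos,
        ENNReal.ofReal_ofNat]
    have h1 : ENNReal.ofReal (1 - (half : ℝ)) = 2⁻¹ := by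
      rw [← h0, show (half : ℝ) = 2⁻¹ from one_div 2]
      norm_num
    rw [cantorMeasure_selfSimilar half, h0, h1, Measure.add_apply, Measure.smul_apply,
      Measure.smul_apply, Measure.map_apply (continuous_branchMap _).measurable
      (measurableSet_cylinder _), Measure.map_apply (continuous_branchMap _).measurable
      (measurableSet_cylinder _)]
    cases b
    · rw [branchMap_preimage_cylinder_cons,
        cantorMeasure_branchMap_preimage_cylinder_cons half (by decide), ih]
      simp [pow_succ, mul_comm]
    · rw [branchMap_preimage_cylinder_cons,
        cantorMeasure_branchMap_preimage_cylinder_cons half (by decide), ih]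
      simp [pow_succ, mul_comm]

lemma coeFn_Lp_sum {α ι E : Type*} [MeasurableSpace α] {μ : Measure α} [NormedAddCommGroup E]
    {q : ℝ≥0∞} (s : Finset ι) (f : ι → Lp E q μ) :
    ⇑(∑ i ∈ s, f i) =ᵐ[μ] ∑ i ∈ s, ⇑(f i) := by
  classical
  induction s using Finset.induction_on with
  | empty => simpa using Lp.coeFn_zero E q μ
  | insert a s ha ih =>
    rw [Finset.sum_insert ha, Finset.sum_insert ha]
    filter_upwards [Lp.coeFn_add (f a) (∑ i ∈ s, f i), ih] with x h1 h2
    rw [h1, Pi.add_apply, Pi.add_apply, h2]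

/-! ### The span of the cylinder indicators of a given level -/

section Level

variable (𝕜 : Type*) [RCLike 𝕜]

/-- The span of the indicators of the cylinders of level `n`. -/
noncomputable def levelSpan (p : unitInterval) (n : ℕ) : Submodule 𝕜 (Lp 𝕜 2 (cantorMeasure p)) :=
  Submodule.span 𝕜 (Set.range fun u : Fin n → Bool => cylinderIndicator 𝕜 p (List.ofFn u))

instance (p : unitInterval) (n : ℕ) : FiniteDimensional 𝕜 (levelSpan 𝕜 p n) :=
  FiniteDimensional.span_of_finite 𝕜 (Set.finite_range _)

lemma cylinderIndicator_mem_levelSpan (p : unitInterval) {n : ℕ} (u : Fin n → Bool) :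
    cylinderIndicator 𝕜 p (List.ofFn u) ∈ levelSpan 𝕜 p n :=
  Submodule.subset_span ⟨u, rfl⟩

lemma cylinderIndicator_mem_levelSpan_of_length (p : unitInterval) {n : ℕ} {w : List Bool}
    (hw : w.length = n) : cylinderIndicator 𝕜 p w ∈ levelSpan 𝕜 p n := by
  subst hw
  simpa using cylinderIndicator_mem_levelSpan 𝕜 p w.get

lemma cylinderIndicator_eq_add (p : unitInterval) (w : List Bool) :
    cylinderIndicator 𝕜 p w =
      cylinderIndicator 𝕜 p (w ++ [false]) + cylinderIndicator 𝕜 p (w ++ [true]) := by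
  have hd : Disjoint (cylinder (w ++ [false])) (cylinder (w ++ [true])) :=
    disjoint_cylinder (by simp) (by simp)
  have := indicatorConstLp_disjoint_union (p := 2) (measurableSet_cylinder (w ++ [false]))
    (measurableSet_cylinder (w ++ [true])) (measure_ne_top (cantorMeasure p) _)
    (measure_ne_top (cantorMeasure p) _) hd (1 : 𝕜)
  rw [cylinderIndicator, cylinderIndicator, cylinderIndicator, ← this]
  simp only [← cylinder_eq_union]

lemma monotone_levelSpan (p : unitInterval) : Monotone (levelSpan 𝕜 p) := by
  refine monotone_nat_of_le_succ fun n => Submodule.span_le.2 ?_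
  rintro _ ⟨u, rfl⟩
  simp only [SetLike.mem_coe]
  rw [cylinderIndicator_eq_add]
  exact add_mem (cylinderIndicator_mem_levelSpan_of_length 𝕜 p (by simp))
    (cylinderIndicator_mem_levelSpan_of_length 𝕜 p (by simp))

lemma inner_cylinderIndicator_of_ne (p : unitInterval) {n : ℕ} {u v : Fin n → Bool}
    (h : u ≠ v) :
    ⟪cylinderIndicator 𝕜 p (List.ofFn u), cylinderIndicator 𝕜 p (List.ofFn v)⟫_𝕜 = 0 := by
  rw [cylinderIndicator, cylinderIndicator,
    L2.inner_indicatorConstLp_one_indicatorConstLp_one,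
    (disjoint_cylinder (by simp) (List.ofFn_injective.ne h)).inter_eq]
  simp

lemma inner_cylinderIndicator_self (w : List Bool) :
    ⟪cylinderIndicator 𝕜 half w, cylinderIndicator 𝕜 half w⟫_𝕜 = 2⁻¹ ^ w.length := by
  rw [cylinderIndicator, L2.inner_indicatorConstLp_one_indicatorConstLp_one, Set.inter_self,
    measureReal_def, cantorMeasure_half_cylinder]
  simp [map_ofNat]

lemma finrank_levelSpan (n : ℕ) : Module.finrank 𝕜 (levelSpan 𝕜 half n) = 2 ^ n := by
  have hli : LinearIndependent 𝕜
      fun u : Fin n → Bool => cylinderIndicator 𝕜 half (List.ofFn u) := by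
    refine linearIndependent_of_ne_zero_of_inner_eq_zero (fun u h => ?_)
      fun u v h => inner_cylinderIndicator_of_ne 𝕜 half h
    have := inner_cylinderIndicator_self 𝕜 (List.ofFn u)
    rw [h, inner_zero_left] at this
    exact pow_ne_zero _ (inv_ne_zero two_ne_zero) this.symm
  rw [levelSpan, finrank_span_eq_card hli]
  simp

/-! ### Conditional expectations as orthogonal projections -/

lemma subset_or_disjoint_of_measurableSet_levelSigma {n : ℕ} {A : Set ℝ}
    (hA : MeasurableSet[levelSigma n] A) (u : Fin n → Bool) :
    cylinder (List.ofFn u) ⊆ A ∨ cylinder (List.ofFn u) ⊆ Aᶜ := by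
  induction A, hA using MeasurableSpace.generateFrom_induction with
  | hC A hA _ =>
    obtain ⟨v, rfl⟩ := hA
    by_cases h : u = v
    · exact Or.inl (by rw [h])
    · exact Or.inr (disjoint_cylinder (by simp) (List.ofFn_injective.ne h)).subset_compl_right
  | empty => simp
  | compl A _ ih => simpa using ih.symm
  | iUnion s _ ih =>
    by_cases h : ∃ i, cylinder (List.ofFn u) ⊆ s i
    · obtain ⟨i, hi⟩ := h
      exact Or.inl (hi.trans (Set.subset_iUnion s i))
    · push Not at h
      rw [Set.compl_iUnion]
      exact Or.inr (Set.subset_iInter fun i => (ih i).resolve_left (h i))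

/-- A `levelSigma n`-measurable function is constant on each level-n cylinder, and these cylinders
cover almost every point. -/
lemma lpMeas_levelSigma (p : unitInterval) (n : ℕ) :
    lpMeas 𝕜 𝕜 (levelSigma n) 2 (cantorMeasure p) = levelSpan 𝕜 p n := by
  refine le_antisymm (fun f hf => ?_) (Submodule.span_le.2 ?_)
  · obtain ⟨g, hg, hfg⟩ := mem_lpMeas_iff_aestronglyMeasurable.1 hf
    choose x hx using fun u : Fin n → Bool => cylinder_nonempty (List.ofFn u)
    have hconst : ∀ u, ∀ y ∈ cylinder (List.ofFn u), g y = g (x u) := by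
      intro u y hy
      -- The level set through `x u` contains the whole cylinder or misses it, and it contains `x
      -- u`.
      have hm : MeasurableSet[levelSigma n] (g ⁻¹' {g (x u)}) :=
        hg.measurable (measurableSet_singleton _)
      rcases subset_or_disjoint_of_measurableSet_levelSigma hm u with h | h
      · exact h hy
      · exact absurd rfl (h (hx u))
    have hfeq : f = ∑ u : Fin n → Bool, g (x u) • cylinderIndicator 𝕜 p (List.ofFn u) := by
      refine Lp.ext ?_
      have hind : ∀ᵐ y ∂(cantorMeasure p), ∀ u : Fin n → Bool,
          (g (x u) • cylinderIndicator 𝕜 p (List.ofFn u)) y =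
            (cylinder (List.ofFn u)).indicator (fun _ => g (x u)) y := by
        refine ae_all_iff.2 fun u => ?_
        filter_upwards [Lp.coeFn_smul (g (x u)) (cylinderIndicator 𝕜 p (List.ofFn u)),
          indicatorConstLp_coeFn (p := 2) (hs := measurableSet_cylinder (List.ofFn u))
            (hμs := measure_ne_top (cantorMeasure p) _) (c := (1 : 𝕜))] with y h1 h2
        rw [h1, Pi.smul_apply, cylinderIndicator, h2]
        by_cases hy : y ∈ cylinder (List.ofFn u) <;> simp [hy]
      filter_upwards [hfg, hind, ae_mem_cantorSet p, coeFn_Lp_sum Finset.univ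
        fun u : Fin n → Bool => g (x u) • cylinderIndicator 𝕜 p (List.ofFn u)]
        with y h1 h2 hy h3
      obtain ⟨v, hv⟩ := exists_mem_cylinder hy n
      rw [h1, h3, Finset.sum_apply, Finset.sum_congr rfl fun u _ => h2 u,
        Finset.sum_eq_single v, Set.indicator_of_mem hv, hconst v y hv]
      · intro u _ huv
        exact Set.indicator_of_notMem (fun hu => Set.disjoint_left.1
          (disjoint_cylinder (by simp) (List.ofFn_injective.ne huv)) hu hv) _
      · simp
    rw [hfeq]
    exact Submodule.sum_mem _ fun u _ =>
      Submodule.smul_mem _ _ (cylinderIndicator_mem_levelSpan 𝕜 p u)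
  · rintro _ ⟨u, rfl⟩
    exact mem_lpMeas_indicatorConstLp (levelSigma_le n)
      (MeasurableSpace.measurableSet_generateFrom ⟨u, rfl⟩) (measure_ne_top _ _)

lemma levelExpectation_eq_starProjection (p : unitInterval) (n : ℕ) :
    levelExpectation 𝕜 p n = (levelSpan 𝕜 p n).starProjection := by
  have : Fact (levelSigma n ≤ Real.measurableSpace) := ⟨levelSigma_le n⟩
  have h : levelExpectation 𝕜 p n =
    (lpMeas 𝕜 𝕜 (levelSigma n) 2 (cantorMeasure p)).starProjection := rfl
  rw [h]
  simp only [lpMeas_levelSigma]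

lemma limitOperator_eq_dyadicSum : limitOperator 𝕜 = dyadicSum (levelSpan 𝕜 half) := by
  simp only [limitOperator, dyadicSum, levelExpectation_eq_starProjection]

/-- The symmetry p = 1/2 is decisive here: all level-n cylinders have the same mass, so a single
scalar normalises the orthogonal family. -/
lemma sum_rankOne_cylinderIndicator (n : ℕ) :
    ∑ u : Fin n → Bool, InnerProductSpace.rankOne 𝕜 (cylinderIndicator 𝕜 half (List.ofFn u))
      (cylinderIndicator 𝕜 half (List.ofFn u)) =
    ((2 : 𝕜)⁻¹ ^ n) • levelExpectation 𝕜 half n := by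
  have h2 : (2 : 𝕜) ^ n * 2⁻¹ ^ n = 1 := by
    rw [← mul_pow, mul_inv_cancel₀ two_ne_zero, one_pow]
  rw [levelExpectation_eq_starProjection]
  ext1 f
  set g := ∑ u : Fin n → Bool, ⟪cylinderIndicator 𝕜 half (List.ofFn u), f⟫_𝕜 •
    cylinderIndicator 𝕜 half (List.ofFn u) with hg
  -- The factor 2ⁿ is the inverse of the common squared norm; orthogonality of the remainder need
  -- only be tested on the indicators.
  have hproj : (levelSpan 𝕜 half n).starProjection f = (2 : 𝕜) ^ n • g := by
    refine Submodule.eq_starProjection_of_mem_orthogonal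
      (Submodule.smul_mem _ _ (Submodule.sum_mem _ fun u _ =>
        Submodule.smul_mem _ _ (cylinderIndicator_mem_levelSpan 𝕜 half u))) ?_
    refine (Submodule.mem_orthogonal _ _).2 fun h hh => ?_
    induction hh using Submodule.span_induction with
    | mem h hh =>
      obtain ⟨v, rfl⟩ := hh
      simp only [hg]
      rw [inner_sub_right, inner_smul_right, inner_sum, Finset.sum_eq_single v,
        inner_smul_right, inner_cylinderIndicator_self, List.length_ofFn]
      · linear_combination (-⟪cylinderIndicator 𝕜 half (List.ofFn v), f⟫_𝕜) * h2
      · intro u _ huv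
        rw [inner_smul_right, inner_cylinderIndicator_of_ne 𝕜 half huv.symm, mul_zero]
      · simp
    | zero => simp
    | add a b _ _ ha hb => rw [inner_add_left, ha, hb, add_zero]
    | smul c a _ ha => rw [inner_smul_left, ha, mul_zero]
  rw [smul_apply, hproj, smul_smul, mul_comm, h2, one_smul,
    sum_apply]
  rfl

lemma tendsto_frameOperator :
    Tendsto (fun m : ℕ => frameOperator 𝕜 half m) atTop (𝓝 (limitOperator 𝕜)) := by
  have h := (summable_limitOperator 𝕜).hasSum.tendsto_sum_nat
  simpa only [frameOperator, sum_rankOne_cylinderIndicator, limitOperator, Function.comp_def]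
    -- The shift by 1 accounts for K_m containing the m + 1 levels 0, …, m.
    using h.comp (tendsto_add_atTop_nat 1)

lemma memSchatten_limitOperator_iff (r : ℝ) : MemSchatten (limitOperator 𝕜) r ↔ 1 < r := by
  rw [limitOperator_eq_dyadicSum]
  exact memSchatten_dyadicSum_iff (monotone_levelSpan 𝕜 half) (finrank_levelSpan 𝕜) r

end Level

end CantorFrame
theorem corollary3p7 (𝕜 : Type*) [RCLike 𝕜] :
    Filter.Tendsto (fun m : ℕ => CantorFrame.frameOperator 𝕜 CantorFrame.half m) Filter.atTop
      (nhds (CantorFrame.limitOperator 𝕜)) ∧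
    (∀ r : ℝ, 0 < r → (CantorFrame.MemSchatten (CantorFrame.limitOperator 𝕜) r ↔ 1 < r)) ∧
    CantorFrame.IsHilbertSchmidt (CantorFrame.limitOperator 𝕜) ∧
    ¬ CantorFrame.IsTraceClass (CantorFrame.limitOperator 𝕜) := by
  refine ⟨CantorFrame.tendsto_frameOperator 𝕜,
    fun r _ => CantorFrame.memSchatten_limitOperator_iff 𝕜 r,
    (CantorFrame.memSchatten_limitOperator_iff 𝕜 2).2 one_lt_two,
    fun h => lt_irrefl _ ((CantorFrame.memSchatten_limitOperator_iff 𝕜 1).1 h)⟩
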